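/- Consider the following product-selection (semi-bandit) model. There are $N$ products with known feature vectors $x_1,\dots,x_N\in\mathbb{R}^d$ and an unknown vector $\theta^*\in\mathbb{R}^d$ such that $\|x_i\|_2\le 1$, $\|\theta^*\|_2\le 1$ and $\mu(i):=x_i^\top\theta^*\in[0,1]$ for every $i$. In each of $T$ periods $t=1,\dots,T$ a set $S_t$ of exactly $K$ products is offered, chosen on the basis of the information available before period $t$, and then the outcomes $r_{t,i}\in\{0,1\}$, $i\in S_t$, are observed. The variables $r_{t,i}$ are independent across products and periods, $\mathbb{E}[r_{t,i}]=\mu(i)$, and the outcomes of period $t$ are independent of the information available before period $t$. With $S^*$ a set of $K$ products with the largest sum $\sum_{i\in S^*}\mu(i)$, the regret is \[ R(T)=\sum_{t=1}^T\sum_{i\in S^*}\mu(i)-\sum_{t=1}^T\sum_{i\in S_t}\mu(i). \] The algorithm SemiUCB with parameters $\alpha,\omega$ starts from $A_0=\omega I_{d\times d}$, $b_0=0$ and in period $t$ computes $\theta_t=A_{t-1}^{-1}b_{t-1}$ and \[ p_t(i)=x_i^\top\theta_t+\alpha\sqrt{x_i^\top A_{t-1}^{-1}x_i}\qquad (1\le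 i\le N), \] offers a set $S_t\in\arg\max_{|S|=K}\sum_{i\in S}p_t(i)$ (ties broken arbitrarily), and updates \[ A_t=A_{t-1}+\sum_{i\in S_t}x_ix_i^\top,\qquad b_t=b_{t-1}+\sum_{i\in S_t}r_{t,i}x_i . \] Theorem. There are absolute constants $C>0$ and $p\in\mathbb{N}$ such that, for all $d,N,K,T$, all $\delta\in(0,1)$ and all instances of the model, if SemiUCB is run with \[ \alpha=\sqrt{d\log\Big(\frac{1+TN}{\delta}\Big)}+1,\qquad \omega=1, \] then with probability at least $1-\delta$ \[ R(T)\le C\,\big(Kd^{3/2}+d\sqrt{KT}\big)\,\Big(\log\frac{1+TN}{\delta}\Big)^{p}. \] In other words, $R(T)=\tilde O(Kd^{3/2}+d\sqrt{KT})$: up to logarithmic factors, the regret is at most the sum of a fixed cost $Kd^{3/2}$, which does not depend on $T$, and a variable cost $d\sqrt{KT}$. -/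

import Mathlib

open MeasureTheory ProbabilityTheory

/-- The products are indexed by `Fin N`. A set `S` of exactly `K` products belongs to
`argmax_{|S| = K} ∑_{i ∈ S} score i`. -/
def IsTopSet {N : ℕ} (K : ℕ) (score : Fin N → ℝ) (S : Finset (Fin N)) : Prop :=
  S.card = K ∧ ∀ S' : Finset (Fin N), S'.card = K → ∑ i ∈ S', score i ≤ ∑ i ∈ S, score i

/-- The probability `μ(i) = xᵢᵀ θ*` of positive sales of product `i`. -/
noncomputable def saleProb {d N : ℕ} (x : Fin N → EuclideanSpace ℝ (Fin d))
    (θ : EuclideanSpace ℝ (Fin d)) (i : Fin N) : ℝ :=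
  (x i).ofLp ⬝ᵥ θ.ofLp

/-- The matrix `A_t` after `t` periods, for the offered sets `S 0, S 1, …`
(the periods are numbered `0, 1, …`):
`A_0 = w I` and `A_{t+1} = A_t + ∑_{i ∈ S t} xᵢ xᵢᵀ`. -/
noncomputable def designMatrix {d N : ℕ} (w : ℝ) (x : Fin N → EuclideanSpace ℝ (Fin d))
    (S : ℕ → Finset (Fin N)) : ℕ → Matrix (Fin d) (Fin d) ℝ
  | 0 => w • (1 : Matrix (Fin d) (Fin d) ℝ)
  | t + 1 => designMatrix w x S t + ∑ i ∈ S t, Matrix.vecMulVec (x i).ofLp (x i).ofLp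

/-- The vector `b_t` after `t` periods, for the offered sets `S` and the outcomes `r`:
`b_0 = 0` and `b_{t+1} = b_t + ∑_{i ∈ S t} r_{t,i} xᵢ`. Only the outcomes of offered products
are used. -/
noncomputable def responseVector {d N : ℕ} (x : Fin N → EuclideanSpace ℝ (Fin d))
    (S : ℕ → Finset (Fin N)) (r : ℕ → Fin N → ℝ) : ℕ → (Fin d → ℝ)
  | 0 => 0
  | t + 1 => responseVector x S r t + ∑ i ∈ S t, r t i • (x i).ofLp

/-- The estimate of `θ*` used in period `t`: the inverse of the current matrix applied to the
current response vector. -/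
noncomputable def thetaHat {d N : ℕ} (w : ℝ) (x : Fin N → EuclideanSpace ℝ (Fin d))
    (S : ℕ → Finset (Fin N)) (r : ℕ → Fin N → ℝ) (t : ℕ) : Fin d → ℝ :=
  (designMatrix w x S t)⁻¹.mulVec (responseVector x S r t)

/-- The upper confidence value of product `i` used in period `t`, computed from the sets offered
and the outcomes observed before period `t`: `xᵢᵀ θ_t + α √(xᵢᵀ A⁻¹ xᵢ)`. -/
noncomputable def ucbValue {d N : ℕ} (α w : ℝ) (x : Fin N → EuclideanSpace ℝ (Fin d))
    (S : ℕ → Finset (Fin N)) (r : ℕ → Fin N → ℝ) (t : ℕ) (i : Fin N) : ℝ :=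
  (x i).ofLp ⬝ᵥ thetaHat w x S r t +
    α * √((x i).ofLp ⬝ᵥ (designMatrix w x S t)⁻¹.mulVec (x i).ofLp)

/-- The sets offered in the periods `0, …, T - 1` are a run of SemiUCB with parameters `α`, `w`
on the outcomes `r`: in each period, `K` products with the largest sum of upper confidence values
are offered (ties are broken arbitrarily). -/
def IsSemiUCBRun {d N : ℕ} (α w : ℝ) (K T : ℕ) (x : Fin N → EuclideanSpace ℝ (Fin d))
    (S : ℕ → Finset (Fin N)) (r : ℕ → Fin N → ℝ) : Prop :=
  ∀ t < T, IsTopSet K (ucbValue α w x S r t) (S t)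

/-- The regret over `T` periods of offering the sets `S 0, …, S (T - 1)`, against the set `Sopt`
in every period, when the probabilities of positive sales are `μ`. -/
def regret {N : ℕ} (T : ℕ) (μ : Fin N → ℝ) (Sopt : Finset (Fin N))
    (S : ℕ → Finset (Fin N)) : ℝ :=
  ∑ _t ∈ Finset.range T, ∑ i ∈ Sopt, μ i - ∑ t ∈ Finset.range T, ∑ i ∈ S t, μ i

/-! Write ‖y‖ for the norm with square `invQuad A y`, A the design matrix before a period, and s for
the accumulated noise ∑ (r - μ) x. The proof combines a confidence bound, optimism and a determinant
potential.

Confidence: exp(2‖s‖²)/√det A (`expProcess`) has nonincreasing expectation. No Gaussian mixture is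
integrated: adding one product is a rank-one update, and `bernoulli_exp_quadratic_le` shows that a
centred Bernoulli outcome does not increase the conditional mean. Independence lets the products of
a batch be added one at a time (`sum_batchWeight_mul_expProcess_le`). Markov's inequality and a
union bound over the periods give ‖s‖ ≤ √(dL) with L = log((1+TN)/δ), and regularization adds at
most ‖θ‖ ≤ 1; this is the chosen α.

Optimism: on that event each period loses at most 2α times the sum of the widths ‖xᵢ‖ of the offered
products (`sum_le_sum_add_of_isTopSet`).

Potential: A is frozen while K products are offered, so the usual one-vector argument fails when a
batch changes A a lot. Let D be the increase of log det A in the period. If D ≤ 1, the squared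
widths sum to O(D) and the widths to O(√(KD)); if D > 1, the trivial bound K is at most KD. The D
sum to at most d log(1+TN), so the widths sum to Kd + √(KTd) up to logarithms. Multiplying by α ≈ √d
gives the fixed cost Kd^{3/2} and the variable cost d√(KT). -/

/-! ### Rank-one and batch updates of the inverse quadratic form and the determinant. -/

section LinearAlgebra

open Matrix

variable {d : ℕ} {A : Matrix (Fin d) (Fin d) ℝ}

/-- The quadratic form of the inverse matrix. -/
noncomputable def invQuad (A : Matrix (Fin d) (Fin d) ℝ) (x : Fin d → ℝ) : ℝ :=
  x ⬝ᵥ A⁻¹ *ᵥ x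

theorem Matrix.PosDef.dotProduct_inv_mulVec_comm (hA : A.PosDef) (x y : Fin d → ℝ) :
    x ⬝ᵥ A⁻¹ *ᵥ y = y ⬝ᵥ A⁻¹ *ᵥ x := by
  have h : (A⁻¹)ᵀ = A⁻¹ := by
    have := hA.inv.isHermitian
    rwa [IsHermitian, conjTranspose_eq_transpose_of_trivial] at this
  rw [dotProduct_mulVec, dotProduct_comm, ← mulVec_transpose, h]

theorem Matrix.PosDef.invQuad_nonneg (hA : A.PosDef) (x : Fin d → ℝ) : 0 ≤ invQuad A x := by
  simpa [invQuad] using hA.inv.posSemidef.dotProduct_mulVec_nonneg x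

/-- Cauchy–Schwarz for the inner product of A⁻¹: the quadratic t ↦ `invQuad A (x + t • y)` is
nonnegative, so its discriminant is not positive. -/
theorem Matrix.PosDef.sq_dotProduct_inv_mulVec_le (hA : A.PosDef) (x y : Fin d → ℝ) :
    (x ⬝ᵥ A⁻¹ *ᵥ y) ^ 2 ≤ invQuad A x * invQuad A y := by
  have h := discrim_le_zero (a := invQuad A y) (b := 2 * (x ⬝ᵥ A⁻¹ *ᵥ y)) (c := invQuad A x)
    fun t => by
      have h0 := hA.invQuad_nonneg (x + t • y)
      have hc := hA.dotProduct_inv_mulVec_comm y x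
      simp only [invQuad, mulVec_add, mulVec_smul, dotProduct_add, add_dotProduct,
        smul_dotProduct, dotProduct_smul, smul_eq_mul] at h0 ⊢
      rw [hc] at h0
      linarith
  simp only [discrim] at h
  linarith

theorem Matrix.PosDef.abs_dotProduct_inv_mulVec_le (hA : A.PosDef) (x y : Fin d → ℝ) :
    |x ⬝ᵥ A⁻¹ *ᵥ y| ≤ √(invQuad A x) * √(invQuad A y) := by
  rw [← Real.sqrt_mul (hA.invQuad_nonneg x)]
  exact Real.abs_le_sqrt (hA.sq_dotProduct_inv_mulVec_le x y)

theorem Matrix.PosDef.add_vecMulVec_self (hA : A.PosDef) (x : Fin d → ℝ) :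
    (A + vecMulVec x x).PosDef := by
  simpa using hA.add_posSemidef (posSemidef_vecMulVec_self_star x)

theorem Matrix.PosDef.add_sum_vecMulVec {ι : Type*} (hA : A.PosDef) (x : ι → Fin d → ℝ)
    (B : Finset ι) : (A + ∑ i ∈ B, vecMulVec (x i) (x i)).PosDef :=
  hA.add_posSemidef (posSemidef_sum B fun i _ => by
    simpa using posSemidef_vecMulVec_self_star (x i))

theorem Matrix.PosDef.det_add_vecMulVec_self (hA : A.PosDef) (x : Fin d → ℝ) :
    (A + vecMulVec x x).det = A.det * (1 + invQuad A x) := by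
  rw [vecMulVec_eq Unit, det_add_replicateCol_mul_replicateRow hA.det_pos.ne'.isUnit]
  congr 1
  simp only [invQuad, ← replicateRow_vecMul, dotProduct_mulVec, det_unique,
    Matrix.add_apply, Matrix.one_apply_eq]
  rfl

/-- Sherman–Morrison formula, checked by multiplying the right-hand side by A + x xᵀ. -/
theorem Matrix.PosDef.inv_add_vecMulVec_self_mulVec (hA : A.PosDef) (x s : Fin d → ℝ) :
    (A + vecMulVec x x)⁻¹ *ᵥ s =
      A⁻¹ *ᵥ s - ((x ⬝ᵥ A⁻¹ *ᵥ s) / (1 + invQuad A x)) • A⁻¹ *ᵥ x := by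
  have hu := (hA.add_vecMulVec_self x).det_pos.ne'.isUnit
  have hAu := hA.det_pos.ne'.isUnit
  have hv : 1 + invQuad A x ≠ 0 := by linarith [hA.invQuad_nonneg x]
  have key : (A + vecMulVec x x) *ᵥ
      (A⁻¹ *ᵥ s - ((x ⬝ᵥ A⁻¹ *ᵥ s) / (1 + invQuad A x)) • A⁻¹ *ᵥ x) = s := by
    rw [mulVec_sub, mulVec_smul, add_mulVec, add_mulVec, vecMulVec_mulVec, vecMulVec_mulVec,
      mulVec_mulVec, mulVec_mulVec, mul_nonsing_inv _ hAu, one_mulVec, one_mulVec]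
    ext i
    simp only [Pi.sub_apply, Pi.add_apply, Pi.smul_apply, smul_eq_mul, MulOpposite.smul_eq_mul_unop,
      MulOpposite.unop_op]
    change s i + x i * (x ⬝ᵥ A⁻¹ *ᵥ s) -
      (x ⬝ᵥ A⁻¹ *ᵥ s) / (1 + invQuad A x) * (x i + x i * invQuad A x) = s i
    field_simp
    ring
  rw [← key, mulVec_mulVec, nonsing_inv_mul _ hu, one_mulVec, key]

theorem Matrix.PosDef.dotProduct_inv_add_vecMulVec_self (hA : A.PosDef) (x y s : Fin d → ℝ) :
    y ⬝ᵥ (A + vecMulVec x x)⁻¹ *ᵥ s =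
      y ⬝ᵥ A⁻¹ *ᵥ s - (x ⬝ᵥ A⁻¹ *ᵥ s) * (y ⬝ᵥ A⁻¹ *ᵥ x) / (1 + invQuad A x) := by
  rw [hA.inv_add_vecMulVec_self_mulVec, dotProduct_sub, dotProduct_smul, smul_eq_mul]
  ring

theorem Matrix.PosDef.invQuad_add_vecMulVec_self (hA : A.PosDef) (x y : Fin d → ℝ) :
    invQuad (A + vecMulVec x x) y =
      invQuad A y - (x ⬝ᵥ A⁻¹ *ᵥ y) ^ 2 / (1 + invQuad A x) := by
  rw [invQuad, hA.dotProduct_inv_add_vecMulVec_self, hA.dotProduct_inv_mulVec_comm y x, invQuad, sq]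
  rfl

/-- The effect on the quadratic form of adding `x xᵀ` to the matrix and `η x` to the vector. -/
theorem Matrix.PosDef.invQuad_add_vecMulVec_self_add_smul (hA : A.PosDef) (x s : Fin d → ℝ)
    (η : ℝ) :
    invQuad (A + vecMulVec x x) (s + η • x) = invQuad A s +
      (invQuad A x * η ^ 2 + 2 * η * (x ⬝ᵥ A⁻¹ *ᵥ s) - (x ⬝ᵥ A⁻¹ *ᵥ s) ^ 2) /
        (1 + invQuad A x) := by
  have hv : 1 + invQuad A x ≠ 0 := by linarith [hA.invQuad_nonneg x]
  rw [hA.invQuad_add_vecMulVec_self]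
  have h1 : invQuad A (s + η • x) =
      invQuad A s + 2 * η * (x ⬝ᵥ A⁻¹ *ᵥ s) + η ^ 2 * invQuad A x := by
    have hc := hA.dotProduct_inv_mulVec_comm s x
    simp only [invQuad, mulVec_add, mulVec_smul, dotProduct_add, add_dotProduct,
      smul_dotProduct, dotProduct_smul, smul_eq_mul]
    rw [hc]
    ring
  have h2 : x ⬝ᵥ A⁻¹ *ᵥ (s + η • x) = x ⬝ᵥ A⁻¹ *ᵥ s + η * invQuad A x := by
    simp [invQuad, mulVec_add, mulVec_smul, dotProduct_add, dotProduct_smul]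
  rw [h1, h2]
  field_simp
  ring

theorem Matrix.PosDef.invQuad_add_vecMulVec_self_le (hA : A.PosDef) (x y : Fin d → ℝ) :
    invQuad (A + vecMulVec x x) y ≤ invQuad A y := by
  rw [hA.invQuad_add_vecMulVec_self]
  have := hA.invQuad_nonneg x
  have : 0 ≤ (x ⬝ᵥ A⁻¹ *ᵥ y) ^ 2 / (1 + invQuad A x) := by positivity
  linarith

/-- Cauchy–Schwarz applied to the Sherman–Morrison correction. The factor is exactly the determinant
ratio of the update, so these factors multiply up along a batch. -/
theorem Matrix.PosDef.invQuad_le_mul_invQuad_add_vecMulVec_self (hA : A.PosDef)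
    (x y : Fin d → ℝ) :
    invQuad A y ≤ (1 + invQuad A x) * invQuad (A + vecMulVec x x) y := by
  rw [hA.invQuad_add_vecMulVec_self]
  have h1 := hA.invQuad_nonneg x
  have h2 := hA.sq_dotProduct_inv_mulVec_le x y
  have hv : 1 + invQuad A x ≠ 0 := by linarith
  have h3 : (1 + invQuad A x) *
      (invQuad A y - (x ⬝ᵥ A⁻¹ *ᵥ y) ^ 2 / (1 + invQuad A x)) =
      (1 + invQuad A x) * invQuad A y - (x ⬝ᵥ A⁻¹ *ᵥ y) ^ 2 := by
    field_simp
  rw [h3]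
  linarith

variable {ι : Type*} (x : ι → Fin d → ℝ) (B : Finset ι)

theorem Matrix.PosDef.add_sum_vecMulVec_insert [DecidableEq ι] {j : ι} (hj : j ∉ B) :
    A + ∑ i ∈ insert j B, vecMulVec (x i) (x i) =
      (A + ∑ i ∈ B, vecMulVec (x i) (x i)) + vecMulVec (x j) (x j) := by
  rw [Finset.sum_insert hj]
  abel

theorem Matrix.PosDef.invQuad_add_sum_vecMulVec_le (hA : A.PosDef) (y : Fin d → ℝ) :
    invQuad (A + ∑ i ∈ B, vecMulVec (x i) (x i)) y ≤ invQuad A y := by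
  classical
  induction B using Finset.induction_on with
  | empty => simp
  | insert j B hj ih =>
    rw [add_sum_vecMulVec_insert x B hj]
    exact ((hA.add_sum_vecMulVec x B).invQuad_add_vecMulVec_self_le _ _).trans ih

/-- Passing from `A` to `A + ∑ xᵢ xᵢᵀ` decreases the inverse quadratic form at most by the ratio
of the determinants. -/
theorem Matrix.PosDef.det_mul_invQuad_le (hA : A.PosDef) (y : Fin d → ℝ) :
    A.det * invQuad A y ≤ (A + ∑ i ∈ B, vecMulVec (x i) (x i)).det *
      invQuad (A + ∑ i ∈ B, vecMulVec (x i) (x i)) y := by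
  classical
  induction B using Finset.induction_on with
  | empty => simp
  | insert j B hj ih =>
    have hB := hA.add_sum_vecMulVec x B
    rw [add_sum_vecMulVec_insert x B hj, hB.det_add_vecMulVec_self, mul_assoc]
    exact ih.trans (mul_le_mul_of_nonneg_left
      (hB.invQuad_le_mul_invQuad_add_vecMulVec_self _ _) hB.det_pos.le)

/-- Measured after the update, a new vector has squared width v/(1+v) = 1 - 1/(1+v) ≤ log(1+v), its
own contribution to log det; later updates only shrink it. Using the final matrix makes a cap on v
unnecessary. -/
theorem Matrix.PosDef.sum_invQuad_le_log_det_sub (hA : A.PosDef) :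
    ∑ i ∈ B, invQuad (A + ∑ i ∈ B, vecMulVec (x i) (x i)) (x i) ≤
      Real.log (A + ∑ i ∈ B, vecMulVec (x i) (x i)).det - Real.log A.det := by
  classical
  induction B using Finset.induction_on with
  | empty => simp
  | insert j B hj ih =>
    have hB := hA.add_sum_vecMulVec x B
    rw [add_sum_vecMulVec_insert x B hj, hB.det_add_vecMulVec_self, Finset.sum_insert hj]
    set A' := A + ∑ i ∈ B, vecMulVec (x i) (x i)
    have hv := hB.invQuad_nonneg (x j)
    have h1 : 1 + invQuad A' (x j) ≠ 0 := by linarith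
    rw [Real.log_mul hB.det_pos.ne' h1]
    have h2 : ∑ i ∈ B, invQuad (A' + vecMulVec (x j) (x j)) (x i) ≤ ∑ i ∈ B, invQuad A' (x i) :=
      Finset.sum_le_sum fun i _ => hB.invQuad_add_vecMulVec_self_le _ _
    have h3 : invQuad (A' + vecMulVec (x j) (x j)) (x j) = 1 - (1 + invQuad A' (x j))⁻¹ := by
      rw [hB.invQuad_add_vecMulVec_self]
      change invQuad A' (x j) - (invQuad A' (x j)) ^ 2 / (1 + invQuad A' (x j)) = _
      field_simp
      ring
    have h4 := Real.one_sub_inv_le_log_of_pos (x := 1 + invQuad A' (x j)) (by linarith)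
    linarith

theorem Matrix.PosDef.det_le_det_add_sum_vecMulVec (hA : A.PosDef) :
    A.det ≤ (A + ∑ i ∈ B, vecMulVec (x i) (x i)).det := by
  classical
  induction B using Finset.induction_on with
  | empty => simp
  | insert j B hj ih =>
    have hB := hA.add_sum_vecMulVec x B
    rw [add_sum_vecMulVec_insert x B hj, hB.det_add_vecMulVec_self]
    nlinarith [hB.det_pos, hB.invQuad_nonneg (x j)]

/-- The sum of the squared widths of a batch is controlled by the growth of the determinant. -/
theorem Matrix.PosDef.sum_invQuad_le (hA : A.PosDef) {D : ℝ}
    (hD : D = Real.log (A + ∑ i ∈ B, vecMulVec (x i) (x i)).det - Real.log A.det) :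
    ∑ i ∈ B, invQuad A (x i) ≤ Real.exp D * D := by
  have hB := hA.add_sum_vecMulVec x B
  -- The determinant ratio is the price, by `det_mul_invQuad_le`, of replacing A by the matrix after
  -- the batch.
  have he : Real.exp D = (A + ∑ i ∈ B, vecMulVec (x i) (x i)).det / A.det := by
    rw [hD, Real.exp_sub, Real.exp_log hB.det_pos, Real.exp_log hA.det_pos]
  calc ∑ i ∈ B, invQuad A (x i)
      ≤ ∑ i ∈ B, Real.exp D * invQuad (A + ∑ i ∈ B, vecMulVec (x i) (x i)) (x i) := by
        refine Finset.sum_le_sum fun i _ => ?_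
        have := hA.det_mul_invQuad_le x B (x i)
        rw [he, div_mul_eq_mul_div, le_div_iff₀ hA.det_pos]
        linarith
    _ ≤ Real.exp D * D := by
        rw [← Finset.mul_sum]
        refine mul_le_mul_of_nonneg_left ?_ (Real.exp_pos _).le
        rw [hD]
        exact hA.sum_invQuad_le_log_det_sub x B

/-- Each eigenvalue is the Rayleigh quotient of a unit eigenvector, hence at most c. -/
theorem Matrix.PosDef.det_le_pow (hA : A.PosDef) {c : ℝ}
    (h : ∀ v : Fin d → ℝ, v ⬝ᵥ A *ᵥ v ≤ c * (v ⬝ᵥ v)) : A.det ≤ c ^ d := by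
  have hH := hA.isHermitian
  rw [hH.det_eq_prod_eigenvalues]
  calc ∏ i, ((hH.eigenvalues i : ℝ) : ℝ) ≤ ∏ _i : Fin d, c := by
        refine Finset.prod_le_prod (fun i _ => (hA.eigenvalues_pos i).le) fun i _ => ?_
        have h1 := h (hH.eigenvectorBasis i).ofLp
        have h2 : (hH.eigenvectorBasis i).ofLp ⬝ᵥ (hH.eigenvectorBasis i).ofLp = 1 := by
          have := hH.eigenvectorBasis.orthonormal.1 i
          have h3 := real_inner_self_eq_norm_sq (hH.eigenvectorBasis i)
          rw [this, EuclideanSpace.inner_eq_star_dotProduct] at h3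
          simpa using h3
        have h4 := hH.eigenvalues_eq i
        simp only [star_trivial, RCLike.re_to_real] at h4
        rw [h2, ← h4] at h1
        simpa using h1
    _ = c ^ d := by simp

end LinearAlgebra
-- Exponential moments of a centred Bernoulli variable.
section Bernoulli

/-- Hoeffding's lemma for an interval of length 1, read off from an explicit two-point measure. -/
theorem hoeffding_bernoulli {p : ℝ} (hp : p ∈ Set.Icc (0 : ℝ) 1) (t : ℝ) :
    p * Real.exp (t * (1 - p)) + (1 - p) * Real.exp (t * (0 - p)) ≤ Real.exp (t ^ 2 / 8) := by
  obtain ⟨h0, h1⟩ := hp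
  let ν : Measure ℝ :=
    ENNReal.ofReal p • Measure.dirac 1 + ENNReal.ofReal (1 - p) • Measure.dirac 0
  have hprob : IsProbabilityMeasure ν := ⟨by
    simp [ν, ← ENNReal.ofReal_add h0 (sub_nonneg.2 h1)]⟩
  have hint (f : ℝ → ℝ) : ∫ y, f y ∂ν = p * f 1 + (1 - p) * f 0 := by
    have hi (a : ℝ) : Integrable f (Measure.dirac a) := integrable_dirac (by simp)
    rw [integral_add_measure ((hi 1).smul_measure (by simp)) ((hi 0).smul_measure (by simp)),
      integral_smul_measure, integral_smul_measure, integral_dirac, integral_dirac]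
    simp [ENNReal.toReal_ofReal h0, ENNReal.toReal_ofReal (sub_nonneg.2 h1)]
  have hsub := hasSubgaussianMGF_of_mem_Icc (μ := ν) (X := id) (a := 0) (b := 1)
    aemeasurable_id (by
      rw [ae_add_measure_iff]
      constructor <;> refine Measure.ae_smul_measure ?_ _ <;> simp)
  have h := hsub.mgf_le t
  rw [mgf, hint, hint] at h
  simp only [id, mul_one, mul_zero, add_zero] at h
  refine h.trans (Real.exp_le_exp.2 (le_of_eq ?_))
  norm_num
  ring

/-- One step of the self-normalized bound for a centred Bernoulli variable. -/
theorem bernoulli_exp_quadratic_le {p : ℝ} (hp : p ∈ Set.Icc (0 : ℝ) 1) {v : ℝ} (hv : 0 ≤ v)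
    (u : ℝ) :
    p * Real.exp (2 * ((v * (1 - p) ^ 2 + 2 * (1 - p) * u - u ^ 2) / (1 + v))) +
      (1 - p) * Real.exp (2 * ((v * (0 - p) ^ 2 + 2 * (0 - p) * u - u ^ 2) / (1 + v))) ≤
      √(1 + v) := by
  have hv1 : 0 < 1 + v := by linarith
  -- A centred Bernoulli value η satisfies η² = p(1-p) + (1-2p)η, so the exponent is affine: c + tη.
  set c := 2 * (v * p * (1 - p) - u ^ 2) / (1 + v) with hc
  set t := 2 * (v * (1 - 2 * p) + 2 * u) / (1 + v) with ht
  have e1 : 2 * ((v * (1 - p) ^ 2 + 2 * (1 - p) * u - u ^ 2) / (1 + v)) = c + t * (1 - p) := by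
    rw [hc, ht]; field_simp; ring
  have e2 : 2 * ((v * (0 - p) ^ 2 + 2 * (0 - p) * u - u ^ 2) / (1 + v)) = c + t * (0 - p) := by
    rw [hc, ht]; field_simp; ring
  have hexp : c + t ^ 2 / 8 ≤ Real.log (1 + v) / 2 := by
    have h1 : c + t ^ 2 / 8 ≤ (1 - (1 + v)⁻¹) / 2 := by
      -- The gap is a perfect square because the factor 2 in the exponent matches Hoeffding's
      -- variance proxy 1/4.
      have : (1 - (1 + v)⁻¹) / 2 - (c + t ^ 2 / 8) =
          v * ((1 - 2 * p) - 2 * u) ^ 2 / (2 * (1 + v) ^ 2) := by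
        rw [hc, ht]; field_simp; ring
      have : 0 ≤ v * ((1 - 2 * p) - 2 * u) ^ 2 / (2 * (1 + v) ^ 2) := by positivity
      linarith
    linarith [Real.one_sub_inv_le_log_of_pos hv1]
  rw [e1, e2, Real.exp_add, Real.exp_add]
  calc p * (Real.exp c * Real.exp (t * (1 - p))) + (1 - p) * (Real.exp c * Real.exp (t * (0 - p)))
      = Real.exp c * (p * Real.exp (t * (1 - p)) + (1 - p) * Real.exp (t * (0 - p))) := by ring
    _ ≤ Real.exp c * Real.exp (t ^ 2 / 8) :=
        mul_le_mul_of_nonneg_left (hoeffding_bernoulli hp t) (Real.exp_pos _).le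
    _ ≤ Real.exp (Real.log (1 + v) / 2) := by
        rw [← Real.exp_add]
        exact Real.exp_le_exp.2 hexp
    _ = √(1 + v) := by
        rw [Real.sqrt_eq_rpow, Real.rpow_def_of_pos hv1]
        ring_nf

end Bernoulli

/-! ### The exponential process does not grow on average over one batch. -/

section Mixture

open Matrix

variable {d : ℕ}

/-- The exponential process of the self-normalized concentration inequality. -/
noncomputable def expProcess (z : Matrix (Fin d) (Fin d) ℝ × (Fin d → ℝ)) : ℝ :=
  Real.exp (2 * invQuad z.1 z.2) / √z.1.det

theorem expProcess_nonneg (z : Matrix (Fin d) (Fin d) ℝ × (Fin d → ℝ)) : 0 ≤ expProcess z := by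
  unfold expProcess
  positivity

/-- The rank-one update multiplies √det by √(1+v), which cancels the bound of
`bernoulli_exp_quadratic_le`. -/
theorem expProcess_step {A : Matrix (Fin d) (Fin d) ℝ} (hA : A.PosDef) (x s : Fin d → ℝ)
    {p : ℝ} (hp : p ∈ Set.Icc (0 : ℝ) 1) :
    p * expProcess (A + vecMulVec x x, s + (1 - p) • x) +
      (1 - p) * expProcess (A + vecMulVec x x, s + (0 - p) • x) ≤ expProcess (A, s) := by
  have hv := hA.invQuad_nonneg x
  have h := bernoulli_exp_quadratic_le hp hv (x ⬝ᵥ A⁻¹ *ᵥ s)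
  have hb : 0 < √(1 + invQuad A x) := Real.sqrt_pos.2 (by linarith)
  have hE : 0 ≤ expProcess (A, s) := expProcess_nonneg _
  have key (η : ℝ) : expProcess (A + vecMulVec x x, s + η • x) =
      expProcess (A, s) / √(1 + invQuad A x) *
        Real.exp (2 *
          ((invQuad A x * η ^ 2 + 2 * η * (x ⬝ᵥ A⁻¹ *ᵥ s) - (x ⬝ᵥ A⁻¹ *ᵥ s) ^ 2) / (1 + invQuad A x))) := by
    simp only [expProcess]
    rw [hA.invQuad_add_vecMulVec_self_add_smul, hA.det_add_vecMulVec_self,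
      Real.sqrt_mul hA.det_pos.le, mul_add, Real.exp_add]
    ring
  rw [key, key]
  have h1 := mul_le_mul_of_nonneg_left h (div_nonneg hE hb.le)
  rw [div_mul_cancel₀ _ hb.ne'] at h1
  linarith

variable {ι : Type*} [DecidableEq ι]

/-- The state reached from `z` when the batch `B` is offered and has the successes `U`. -/
noncomputable def stateStep (x : ι → Fin d → ℝ) (μ : ι → ℝ) (B U : Finset ι)
    (z : Matrix (Fin d) (Fin d) ℝ × (Fin d → ℝ)) : Matrix (Fin d) (Fin d) ℝ × (Fin d → ℝ) :=
  (z.1 + ∑ i ∈ B, vecMulVec (x i) (x i),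
    z.2 + ∑ i ∈ B, ((if i ∈ U then 1 else 0) - μ i) • x i)

/-- The probability that exactly the members `U` of the batch `B` succeed. -/
noncomputable def batchWeight (μ : ι → ℝ) (B U : Finset ι) : ℝ :=
  ∏ i ∈ B, if i ∈ U then μ i else 1 - μ i

theorem batchWeight_nonneg {μ : ι → ℝ} (hμ : ∀ i, μ i ∈ Set.Icc (0 : ℝ) 1) (B U : Finset ι) :
    0 ≤ batchWeight μ B U :=
  Finset.prod_nonneg fun i _ => by
    split_ifs
    · exact (hμ i).1
    · linarith [(hμ i).2]

theorem sum_batchWeight_mul_expProcess_le (x : ι → Fin d → ℝ) {μ : ι → ℝ}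
    (hμ : ∀ i, μ i ∈ Set.Icc (0 : ℝ) 1) (B : Finset ι)
    {z : Matrix (Fin d) (Fin d) ℝ × (Fin d → ℝ)} (hz : z.1.PosDef) :
    ∑ U ∈ B.powerset, batchWeight μ B U * expProcess (stateStep x μ B U z) ≤ expProcess z := by
  induction B using Finset.induction_on with
  | empty => simp [batchWeight, stateStep]
  | insert j B hj ih =>
    refine le_trans ?_ ih
    -- Success sets are paired as U and `insert j U`: for fixed outcomes in B, only the outcome of j
    -- is averaged.
    rw [Finset.sum_powerset_insert hj, ← Finset.sum_add_distrib]
    refine Finset.sum_le_sum fun U hU => ?_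
    have hjU : j ∉ U := fun h => hj (Finset.mem_powerset.1 hU h)
    have hne (i) (hi : i ∈ B) : i ≠ j := fun h => hj (h ▸ hi)
    have w1 : batchWeight μ (insert j B) U = (1 - μ j) * batchWeight μ B U := by
      simp [batchWeight, Finset.prod_insert hj, hjU]
    have w2 : batchWeight μ (insert j B) (insert j U) = μ j * batchWeight μ B U := by
      rw [batchWeight, Finset.prod_insert hj, batchWeight]
      simp only [Finset.mem_insert, true_or, if_true]
      congr 1
      exact Finset.prod_congr rfl fun i hi => by simp [hne i hi]
    have s1 : stateStep x μ (insert j B) U z =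
        ((stateStep x μ B U z).1 + vecMulVec (x j) (x j),
          (stateStep x μ B U z).2 + (0 - μ j) • x j) := by
      simp only [stateStep, Finset.sum_insert hj, if_neg hjU]
      congr 1 <;> abel
    have s2 : stateStep x μ (insert j B) (insert j U) z =
        ((stateStep x μ B U z).1 + vecMulVec (x j) (x j),
          (stateStep x μ B U z).2 + (1 - μ j) • x j) := by
      simp only [stateStep, Finset.sum_insert hj, Finset.mem_insert, true_or, if_true]
      have : ∑ i ∈ B, ((if i = j ∨ i ∈ U then (1 : ℝ) else 0) - μ i) • x i =
          ∑ i ∈ B, ((if i ∈ U then (1 : ℝ) else 0) - μ i) • x i :=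
        Finset.sum_congr rfl fun i hi => by simp [hne i hi]
      rw [this]
      congr 1 <;> abel
    rw [w1, w2, s1, s2]
    have h := expProcess_step (A := (stateStep x μ B U z).1) (hz.add_sum_vecMulVec x B) (x j)
      (stateStep x μ B U z).2 (hμ j)
    have := mul_le_mul_of_nonneg_left h (batchWeight_nonneg hμ B U)
    linarith

end Mixture
-- Probability: the supermartingale property and the uniform confidence event.
section Noise

open Matrix
open scoped ENNReal

variable {d N : ℕ}

/-- The design matrix and the accumulated weighted noise after `t` periods. -/
noncomputable def noiseState {Ω : Type*} (x : Fin N → EuclideanSpace ℝ (Fin d)) (μ : Fin N → ℝ)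
    (S : ℕ → Ω → Finset (Fin N)) (r : ℕ → Fin N → Ω → ℝ) (t : ℕ) (ω : Ω) :
    Matrix (Fin d) (Fin d) ℝ × (Fin d → ℝ) :=
  (designMatrix 1 x (fun t => S t ω) t,
    responseVector x (fun t => S t ω) (fun t i => r t i ω - μ i) t)

/-- The event that the successes of period `t` inside the batch `B` are exactly `U`. -/
def successEvent {Ω : Type*} (r : ℕ → Fin N → Ω → ℝ) (t : ℕ) (B U : Finset (Fin N)) : Set Ω :=
  ⋂ i ∈ B, r t i ⁻¹' {if i ∈ U then 1 else 0}

theorem designMatrix_posDef (x : Fin N → EuclideanSpace ℝ (Fin d)) (S : ℕ → Finset (Fin N))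
    (t : ℕ) : (designMatrix 1 x S t).PosDef := by
  induction t with
  | zero => simpa [designMatrix] using PosDef.one
  | succ t ih => exact ih.add_sum_vecMulVec (fun i => (x i).ofLp) (S t)

variable {Ω : Type*} {x : Fin N → EuclideanSpace ℝ (Fin d)} {μ : Fin N → ℝ}
  {r : ℕ → Fin N → Ω → ℝ} {S : ℕ → Ω → Finset (Fin N)}

/-- Splitting by offered set B and success set U writes the next state as a finite sum in which the
past and the outcomes of period t enter as separate factors. Both measurability and the expectation
bound rest on this. -/
theorem apply_noiseState_succ {t : ℕ} (hr : ∀ i ω, r t i ω = 0 ∨ r t i ω = 1)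
    (g : Matrix (Fin d) (Fin d) ℝ × (Fin d → ℝ) → ℝ≥0∞) (ω : Ω) :
    g (noiseState x μ S r (t + 1) ω) = ∑ B : Finset (Fin N), ∑ U ∈ B.powerset,
      ({ω | S t ω = B}.indicator 1 ω *
        g (stateStep (fun i => (x i).ofLp) μ B U (noiseState x μ S r t ω))) *
        (successEvent r t B U).indicator 1 ω := by
  classical
  set V := (S t ω).filter fun i => r t i ω = 1 with hV
  have hrV (i) (hi : i ∈ S t ω) : r t i ω = if i ∈ V then 1 else 0 := by
    rcases hr i ω with h | h <;> simp [hV, h, hi]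
  rw [Finset.sum_eq_single (S t ω), Finset.sum_eq_single V]
  · have hmem : ω ∈ successEvent r t (S t ω) V := by
      simp only [successEvent, Set.mem_iInter, Set.mem_preimage, Set.mem_singleton_iff]
      exact hrV
    rw [Set.indicator_of_mem hmem, Set.indicator_of_mem (by simp)]
    simp only [Pi.one_apply, one_mul, mul_one]
    congr 1
    simp only [noiseState, stateStep, designMatrix, responseVector, Prod.mk.injEq, true_and,
      add_right_inj]
    exact Finset.sum_congr rfl fun i hi => by rw [hrV i hi]
  · intro U hU hne
    rw [Set.indicator_of_notMem (s := successEvent r t (S t ω) U), mul_zero]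
    intro hmem
    simp only [successEvent, Set.mem_iInter, Set.mem_preimage, Set.mem_singleton_iff] at hmem
    refine hne (Finset.ext fun i => ?_)
    by_cases hi : i ∈ S t ω
    · have h := (hmem i hi).symm.trans (hrV i hi)
      by_cases hiU : i ∈ U <;> by_cases hiV : i ∈ V <;> simp [hiU, hiV] at h ⊢
    · exact iff_of_false (fun h => hi (Finset.mem_powerset.1 hU h)) (by simp [hV, hi])
  · intro h
    exact absurd (by simp [hV]) h
  · intro B _ hne
    refine Finset.sum_eq_zero fun U _ => ?_
    rw [Set.indicator_of_notMem (s := {ω | S t ω = B}) (by simpa using hne.symm), zero_mul,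
      zero_mul]
  · simp

theorem measurableSet_successEvent {m : MeasurableSpace Ω} {t : ℕ}
    (hr : ∀ i, Measurable[m] (r t i)) (B U : Finset (Fin N)) :
    MeasurableSet[m] (successEvent r t B U) :=
  Finset.measurableSet_biInter B fun i _ => hr i (measurableSet_singleton _)

theorem measurable_indicator_one {m : MeasurableSpace Ω} {E : Set Ω} (hE : MeasurableSet[m] E) :
    Measurable[m] (E.indicator (1 : Ω → ℝ≥0∞)) :=
  measurable_one.indicator hE

variable {mΩ : MeasurableSpace Ω} {P : Measure Ω} {ℱ : Filtration ℕ mΩ} {T : ℕ}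

/-- Any g is allowed, measurable or not, since the state takes finitely many values. Quantifying
over g lets the induction absorb `stateStep` into it. -/
theorem measurable_apply_noiseState
    (hr : ∀ t < T, ∀ i ω, r t i ω = 0 ∨ r t i ω = 1)
    (hrm : ∀ t < T, ∀ i, Measurable[ℱ (t + 1)] (r t i))
    (hS : ∀ t < T, ∀ s : Finset (Fin N), MeasurableSet[ℱ t] {ω | S t ω = s}) {t : ℕ}
    (ht : t ≤ T) (g : Matrix (Fin d) (Fin d) ℝ × (Fin d → ℝ) → ℝ≥0∞) :
    Measurable[ℱ t] fun ω => g (noiseState x μ S r t ω) := by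
  induction t generalizing g with
  | zero => exact @measurable_const _ _ _ (ℱ 0) (g ((1 : ℝ) • 1, 0))
  | succ t ih =>
    have htT : t < T := ht
    have hle : ℱ t ≤ ℱ (t + 1) := ℱ.mono t.le_succ
    simp_rw [apply_noiseState_succ (hr t htT) g]
    refine Finset.measurable_sum _ fun B _ => Finset.measurable_sum _ fun U _ => ?_
    refine Measurable.mul (Measurable.mul ?_ ?_) ?_
    · exact measurable_indicator_one (hle _ (hS t htT B))
    · exact (ih htT.le (fun z => g (stateStep (fun i => (x i).ofLp) μ B U z))).mono hle le_rfl
    · exact measurable_indicator_one (measurableSet_successEvent (hrm t htT) B U)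

theorem measure_eq_one_of_binary {X : Ω → ℝ} [IsProbabilityMeasure P] (hX : Measurable X)
    (h01 : ∀ ω, X ω = 0 ∨ X ω = 1) {p : ℝ} (hp : ∫ ω, X ω ∂P = p) :
    P (X ⁻¹' {1}) = ENNReal.ofReal p ∧ P (X ⁻¹' {0}) = ENNReal.ofReal (1 - p) := by
  have hm1 : MeasurableSet (X ⁻¹' {1}) := hX (measurableSet_singleton _)
  have h1 : P.real (X ⁻¹' {1}) = p := by
    rw [← hp, ← integral_indicator_one hm1]
    congr 1
    ext ω
    rcases h01 ω with h | h <;> simp [h]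
  have h0 : X ⁻¹' {0} = (X ⁻¹' {1})ᶜ := by
    ext ω
    rcases h01 ω with h | h <;> simp [h]
  constructor
  · rw [← h1, ofReal_measureReal]
  · rw [h0, ← h1, ← probReal_compl_eq_one_sub hm1, ofReal_measureReal]

theorem measure_successEvent [IsProbabilityMeasure P]
    (hμ : ∀ i, μ i ∈ Set.Icc (0 : ℝ) 1)
    {t : ℕ} (ht : t < T) (hr : ∀ i ω, r t i ω = 0 ∨ r t i ω = 1)
    (hrm : ∀ i, Measurable (r t i)) (hmean : ∀ i, ∫ ω, r t i ω ∂P = μ i)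
    (hind : iIndepFun (fun (q : Fin T × Fin N) => r q.1 q.2) P) (B U : Finset (Fin N)) :
    P (successEvent r t B U) = ENNReal.ofReal (batchWeight μ B U) := by
  have hind' : iIndepFun (fun i : Fin N => r t i) P :=
    hind.precomp (g := fun i : Fin N => ((⟨t, ht⟩ : Fin T), i)) fun i j h => by simpa using h
  rw [successEvent, hind'.measure_inter_preimage_eq_mul B
    (fun i _ => measurableSet_singleton _), batchWeight, ENNReal.ofReal_prod_of_nonneg]
  · refine Finset.prod_congr rfl fun i _ => ?_
    have h := measure_eq_one_of_binary (hrm i) (hr i) (hmean i)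
    split_ifs
    · exact h.1
    · exact h.2
  · intro i _
    split_ifs
    · exact (hμ i).1
    · linarith [(hμ i).2]

/-- The past is independent of the outcomes of period t, so each success event may be replaced by
its probability `batchWeight`. What remains is the one-batch inequality, applied pointwise. -/
theorem lintegral_expProcess_noiseState_succ_le [IsProbabilityMeasure P]
    (hμ : ∀ i, μ i ∈ Set.Icc (0 : ℝ) 1)
    (hr : ∀ t < T, ∀ i ω, r t i ω = 0 ∨ r t i ω = 1)
    (hmean : ∀ t < T, ∀ i, ∫ ω, r t i ω ∂P = μ i)
    (hind : iIndepFun (fun (q : Fin T × Fin N) => r q.1 q.2) P)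
    (hrm : ∀ t < T, ∀ i, Measurable[ℱ (t + 1)] (r t i))
    (hindF : ∀ t < T, Indep (ℱ t) (⨆ i, MeasurableSpace.comap (r t i) inferInstance) P)
    (hS : ∀ t < T, ∀ s : Finset (Fin N), MeasurableSet[ℱ t] {ω | S t ω = s}) {t : ℕ}
    (ht : t < T) :
    ∫⁻ ω, ENNReal.ofReal (expProcess (noiseState x μ S r (t + 1) ω)) ∂P ≤
      ∫⁻ ω, ENNReal.ofReal (expProcess (noiseState x μ S r t ω)) ∂P := by
  set x' : Fin N → Fin d → ℝ := fun i => (x i).ofLp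
  let G : Matrix (Fin d) (Fin d) ℝ × (Fin d → ℝ) → ℝ≥0∞ := fun z => ENNReal.ofReal (expProcess z)
  let f : Finset (Fin N) → Finset (Fin N) → Ω → ℝ≥0∞ := fun B U ω =>
    {ω | S t ω = B}.indicator 1 ω * G (stateStep x' μ B U (noiseState x μ S r t ω))
  have hfF (B U) : Measurable[ℱ t] (f B U) :=
    (measurable_indicator_one (hS t ht B)).mul
      (measurable_apply_noiseState hr hrm hS ht.le fun z => G (stateStep x' μ B U z))
  have hf (B U) : Measurable (f B U) := (hfF B U).mono (ℱ.le t) le_rfl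
  have hrm' (i) : Measurable (r t i) := (hrm t ht i).mono (ℱ.le _) le_rfl
  have hE (B U) : MeasurableSet (successEvent r t B U) := measurableSet_successEvent hrm' B U
  have hfE (B U) : Measurable fun ω => f B U ω * (successEvent r t B U).indicator 1 ω :=
    (hf B U).mul (measurable_indicator_one (hE B U))
  have hsucc (ω) : G (noiseState x μ S r (t + 1) ω) = ∑ B, ∑ U ∈ B.powerset,
      f B U ω * (successEvent r t B U).indicator 1 ω := apply_noiseState_succ (hr t ht) G ω
  set m' := ⨆ i, MeasurableSpace.comap (r t i) inferInstance with hm'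
  have hm'le : m' ≤ mΩ := iSup_le fun i => (hrm' i).comap_le
  have hE' (B U) : MeasurableSet[m'] (successEvent r t B U) :=
    measurableSet_successEvent (fun i => (comap_measurable (r t i)).mono
      (le_iSup (fun i => MeasurableSpace.comap (r t i) inferInstance) i) le_rfl) B U
  have hprod (B U) : ∫⁻ ω, f B U ω * (successEvent r t B U).indicator 1 ω ∂P =
      ENNReal.ofReal (batchWeight μ B U) * ∫⁻ ω, f B U ω ∂P := by
    rw [lintegral_mul_eq_lintegral_mul_lintegral_of_independent_measurableSpace (ℱ.le t) hm'le
      (hindF t ht) (hfF B U) (measurable_indicator_one (hE' B U)),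
      lintegral_indicator_one (hE B U),
      measure_successEvent hμ ht (hr t ht) hrm' (hmean t ht) hind, mul_comm]
  calc ∫⁻ ω, G (noiseState x μ S r (t + 1) ω) ∂P
      = ∑ B, ∑ U ∈ B.powerset, ∫⁻ ω, f B U ω * (successEvent r t B U).indicator 1 ω ∂P := by
        simp_rw [hsucc]
        rw [lintegral_finsetSum _ fun B _ => Finset.measurable_sum _ fun U _ => hfE B U]
        refine Finset.sum_congr rfl fun B _ => ?_
        rw [lintegral_finsetSum _ fun U _ => hfE B U]
    _ = ∫⁻ ω, ∑ B, ∑ U ∈ B.powerset, ENNReal.ofReal (batchWeight μ B U) * f B U ω ∂P := by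
        rw [lintegral_finsetSum _ fun B _ => Finset.measurable_sum _ fun U _ =>
          (hf B U).const_mul _]
        refine Finset.sum_congr rfl fun B _ => ?_
        rw [lintegral_finsetSum _ fun U _ => (hf B U).const_mul _]
        exact Finset.sum_congr rfl fun U _ => by rw [hprod, lintegral_const_mul _ (hf B U)]
    _ ≤ ∫⁻ ω, G (noiseState x μ S r t ω) ∂P := by
        refine lintegral_mono fun ω => ?_
        dsimp only
        rw [Finset.sum_eq_single (S t ω)]
        · have h := sum_batchWeight_mul_expProcess_le x' hμ (S t ω)
            (z := noiseState x μ S r t ω) (designMatrix_posDef x _ t)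
          simp only [f, G, Set.indicator_of_mem (show ω ∈ {ω' | S t ω' = S t ω} from rfl),
            Pi.one_apply, one_mul, ← ENNReal.ofReal_mul (batchWeight_nonneg hμ _ _)]
          rw [← ENNReal.ofReal_sum_of_nonneg fun U _ =>
            mul_nonneg (batchWeight_nonneg hμ _ _) (expProcess_nonneg _)]
          exact ENNReal.ofReal_le_ofReal h
        · intro B _ hne
          refine Finset.sum_eq_zero fun U _ => ?_
          simp only [f]
          rw [Set.indicator_of_notMem (s := {ω | S t ω = B}) (by simpa using hne.symm), zero_mul,
            mul_zero]
        · simp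

theorem lintegral_expProcess_noiseState_le_one [IsProbabilityMeasure P]
    (hμ : ∀ i, μ i ∈ Set.Icc (0 : ℝ) 1)
    (hr : ∀ t < T, ∀ i ω, r t i ω = 0 ∨ r t i ω = 1)
    (hmean : ∀ t < T, ∀ i, ∫ ω, r t i ω ∂P = μ i)
    (hind : iIndepFun (fun (q : Fin T × Fin N) => r q.1 q.2) P)
    (hrm : ∀ t < T, ∀ i, Measurable[ℱ (t + 1)] (r t i))
    (hindF : ∀ t < T, Indep (ℱ t) (⨆ i, MeasurableSpace.comap (r t i) inferInstance) P)
    (hS : ∀ t < T, ∀ s : Finset (Fin N), MeasurableSet[ℱ t] {ω | S t ω = s}) {t : ℕ}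
    (ht : t ≤ T) :
    ∫⁻ ω, ENNReal.ofReal (expProcess (noiseState x μ S r t ω)) ∂P ≤ 1 := by
  induction t with
  | zero => simp [noiseState, designMatrix, responseVector, expProcess, invQuad]
  | succ t ih =>
    exact (lintegral_expProcess_noiseState_succ_le hμ hr hmean hind hrm hindF hS ht).trans
      (ih (Nat.le_of_succ_le ht))

/-- With probability at least `1 - δ`, the exponential process stays below `T / δ`. -/
theorem measure_exists_expProcess_ge_le [IsProbabilityMeasure P]
    (hμ : ∀ i, μ i ∈ Set.Icc (0 : ℝ) 1)
    (hr : ∀ t < T, ∀ i ω, r t i ω = 0 ∨ r t i ω = 1)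
    (hmean : ∀ t < T, ∀ i, ∫ ω, r t i ω ∂P = μ i)
    (hind : iIndepFun (fun (q : Fin T × Fin N) => r q.1 q.2) P)
    (hrm : ∀ t < T, ∀ i, Measurable[ℱ (t + 1)] (r t i))
    (hindF : ∀ t < T, Indep (ℱ t) (⨆ i, MeasurableSpace.comap (r t i) inferInstance) P)
    (hS : ∀ t < T, ∀ s : Finset (Fin N), MeasurableSet[ℱ t] {ω | S t ω = s})
    {δ : ℝ} (hδ : 0 < δ) (hT : 0 < T) :
    P.real {ω | ∃ t < T, T / δ ≤ expProcess (noiseState x μ S r t ω)} ≤ δ := by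
  have hT' : (0 : ℝ) < T := by exact_mod_cast hT
  have hpos : 0 < T / δ := div_pos hT' hδ
  -- Markov's inequality with expectation at most 1; the T decision times then share the error δ
  -- equally.
  have hmarkov (t) (ht : t < T) :
      P.real {ω | T / δ ≤ expProcess (noiseState x μ S r t ω)} ≤ δ / T := by
    have hm : Measurable fun ω => ENNReal.ofReal (expProcess (noiseState x μ S r t ω)) :=
      (measurable_apply_noiseState (x := x) (μ := μ) hr hrm hS ht.le
        fun z => ENNReal.ofReal (expProcess z)).mono (ℱ.le t) le_rfl
    have h := mul_meas_ge_le_lintegral (μ := P) hm (ENNReal.ofReal (T / δ))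
    have h' := h.trans (lintegral_expProcess_noiseState_le_one hμ hr hmean hind hrm hindF hS ht.le)
    have hset : {ω | ENNReal.ofReal (T / δ) ≤
        ENNReal.ofReal (expProcess (noiseState x μ S r t ω))} =
        {ω | T / δ ≤ expProcess (noiseState x μ S r t ω)} := by
      ext ω
      exact ENNReal.ofReal_le_ofReal_iff (expProcess_nonneg _)
    rw [hset] at h'
    have h2 := ENNReal.toReal_mono ENNReal.one_ne_top h'
    rw [ENNReal.toReal_mul, ENNReal.toReal_ofReal hpos.le, ENNReal.toReal_one] at h2
    change T / δ * P.real _ ≤ 1 at h2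
    rw [← inv_div (T : ℝ) δ, inv_eq_one_div, le_div_iff₀ hpos]
    linarith
  have hsub : {ω | ∃ t < T, T / δ ≤ expProcess (noiseState x μ S r t ω)} =
      ⋃ t ∈ Finset.range T, {ω | T / δ ≤ expProcess (noiseState x μ S r t ω)} := by
    ext ω
    simp
  rw [hsub]
  calc P.real (⋃ t ∈ Finset.range T, {ω | T / δ ≤ expProcess (noiseState x μ S r t ω)})
      ≤ ∑ t ∈ Finset.range T, P.real {ω | T / δ ≤ expProcess (noiseState x μ S r t ω)} :=
        measureReal_biUnion_finset_le _ _
    _ ≤ ∑ _t ∈ Finset.range T, δ / T :=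
        Finset.sum_le_sum fun t ht => hmarkov t (Finset.mem_range.1 ht)
    _ = δ := by
        rw [Finset.sum_const, Finset.card_range, nsmul_eq_mul]
        field_simp

end Noise
-- Deterministic regret analysis on the confidence event.
section Deterministic

open Matrix

variable {d N : ℕ} {x : Fin N → EuclideanSpace ℝ (Fin d)} {θ : EuclideanSpace ℝ (Fin d)}

theorem EuclideanSpace.dotProduct_self_eq_norm_sq (y : EuclideanSpace ℝ (Fin d)) :
    y.ofLp ⬝ᵥ y.ofLp = ‖y‖ ^ 2 := by
  rw [← real_inner_self_eq_norm_sq y, EuclideanSpace.inner_eq_star_dotProduct]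
  simp

/-- The mean part of the responses is ∑ xᵢ xᵢᵀ θ = (A - I)θ. Applying A⁻¹ therefore leaves the
estimation error A⁻¹s - A⁻¹θ, noise plus regularization bias. -/
theorem responseVector_eq (S : ℕ → Finset (Fin N)) (r : ℕ → Fin N → ℝ) (t : ℕ) :
    responseVector x S r t = responseVector x S (fun t i => r t i - saleProb x θ i) t +
      (designMatrix 1 x S t *ᵥ θ.ofLp - θ.ofLp) := by
  induction t with
  | zero => simp [responseVector, designMatrix]
  | succ t ih =>
    have h : (∑ i ∈ S t, vecMulVec (x i).ofLp (x i).ofLp) *ᵥ θ.ofLp =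
        ∑ i ∈ S t, saleProb x θ i • (x i).ofLp := by
      rw [sum_mulVec]
      refine Finset.sum_congr rfl fun i _ => ?_
      rw [vecMulVec_mulVec]
      simp [saleProb]
    simp only [responseVector, designMatrix, add_mulVec, h, sub_smul, Finset.sum_sub_distrib]
    rw [ih]
    abel

theorem invQuad_designMatrix_le (S : ℕ → Finset (Fin N)) (t : ℕ) (y : Fin d → ℝ) :
    invQuad (designMatrix 1 x S t) y ≤ y ⬝ᵥ y := by
  induction t with
  | zero => simp [designMatrix, invQuad]
  | succ t ih =>
    exact ((designMatrix_posDef x S t).invQuad_add_sum_vecMulVec_le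
      (fun i => (x i).ofLp) (S t) y).trans ih

theorem invQuad_designMatrix_le_one (S : ℕ → Finset (Fin N)) (t : ℕ)
    {y : EuclideanSpace ℝ (Fin d)} (hy : ‖y‖ ≤ 1) :
    invQuad (designMatrix 1 x S t) y.ofLp ≤ 1 := by
  refine (invQuad_designMatrix_le S t _).trans ?_
  rw [EuclideanSpace.dotProduct_self_eq_norm_sq]
  exact pow_le_one₀ (norm_nonneg _) hy

theorem abs_dotProduct_thetaHat_sub_le (hθ : ‖θ‖ ≤ 1) (S : ℕ → Finset (Fin N))
    (r : ℕ → Fin N → ℝ) (t : ℕ) (i : Fin N) :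
    |(x i).ofLp ⬝ᵥ thetaHat 1 x S r t - saleProb x θ i| ≤
      (√(invQuad (designMatrix 1 x S t)
        (responseVector x S (fun t i => r t i - saleProb x θ i) t)) + 1) *
        √(invQuad (designMatrix 1 x S t) (x i).ofLp) := by
  have hA := designMatrix_posDef x S t
  set A := designMatrix 1 x S t
  set s := responseVector x S (fun t i => r t i - saleProb x θ i) t
  have h : (x i).ofLp ⬝ᵥ thetaHat 1 x S r t - saleProb x θ i =
      (x i).ofLp ⬝ᵥ A⁻¹ *ᵥ s - (x i).ofLp ⬝ᵥ A⁻¹ *ᵥ θ.ofLp := by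
    rw [thetaHat, responseVector_eq (θ := θ) S r t, mulVec_add, mulVec_sub, mulVec_mulVec,
      nonsing_inv_mul _ hA.det_pos.ne'.isUnit, one_mulVec, dotProduct_add, dotProduct_sub,
      saleProb]
    ring
  rw [h]
  have h1 := hA.abs_dotProduct_inv_mulVec_le (x i).ofLp s
  have h2 := hA.abs_dotProduct_inv_mulVec_le (x i).ofLp θ.ofLp
  have h3 : √(invQuad A θ.ofLp) ≤ 1 :=
    Real.sqrt_le_one.2 (invQuad_designMatrix_le_one S t hθ)
  have h4 := mul_le_mul_of_nonneg_left h3 (Real.sqrt_nonneg (invQuad A (x i).ofLp))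
  have h5 := abs_sub ((x i).ofLp ⬝ᵥ A⁻¹ *ᵥ s) ((x i).ofLp ⬝ᵥ A⁻¹ *ᵥ θ.ofLp)
  linarith

theorem dotProduct_designMatrix_mulVec_le (hx : ∀ i, ‖x i‖ ≤ 1) (S : ℕ → Finset (Fin N)) (t : ℕ)
    (v : Fin d → ℝ) :
    v ⬝ᵥ designMatrix 1 x S t *ᵥ v ≤ (1 + (t : ℝ) * N) * (v ⬝ᵥ v) := by
  induction t with
  | zero => simp [designMatrix]
  | succ t ih =>
    have hv : 0 ≤ v ⬝ᵥ v := by simpa using dotProduct_star_self_nonneg v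
    have hterm (i : Fin N) : v ⬝ᵥ vecMulVec (x i).ofLp (x i).ofLp *ᵥ v ≤ v ⬝ᵥ v := by
      have h1 : v ⬝ᵥ vecMulVec (x i).ofLp (x i).ofLp *ᵥ v = (v ⬝ᵥ (x i).ofLp) ^ 2 := by
        rw [vecMulVec_mulVec, dotProduct_comm (x i).ofLp v]
        simp [sq]
      have h2 := abs_real_inner_le_norm (WithLp.toLp 2 v) (x i)
      have h3 : inner ℝ (WithLp.toLp 2 v) (x i) = v ⬝ᵥ (x i).ofLp := by
        rw [EuclideanSpace.inner_eq_star_dotProduct]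
        simp [dotProduct_comm]
      have h4 := EuclideanSpace.dotProduct_self_eq_norm_sq (WithLp.toLp 2 v)
      change v ⬝ᵥ v = _ at h4
      rw [h1, h4, ← sq_abs, ← h3]
      refine pow_le_pow_left₀ (abs_nonneg _) (h2.trans ?_) 2
      exact mul_le_of_le_one_right (norm_nonneg _) (hx i)
    have hsum : v ⬝ᵥ (∑ i ∈ S t, vecMulVec (x i).ofLp (x i).ofLp) *ᵥ v ≤ N * (v ⬝ᵥ v) := by
      rw [sum_mulVec, dotProduct_sum]
      calc ∑ i ∈ S t, v ⬝ᵥ vecMulVec (x i).ofLp (x i).ofLp *ᵥ v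
          ≤ ∑ _i ∈ S t, v ⬝ᵥ v := Finset.sum_le_sum fun i _ => hterm i
        _ = (S t).card * (v ⬝ᵥ v) := by rw [Finset.sum_const, nsmul_eq_mul]
        _ ≤ N * (v ⬝ᵥ v) := by
            refine mul_le_mul_of_nonneg_right ?_ hv
            exact_mod_cast (Finset.card_le_univ (S t)).trans_eq (Fintype.card_fin N)
    rw [designMatrix, add_mulVec, dotProduct_add]
    push_cast
    linarith

theorem log_det_designMatrix_le (hx : ∀ i, ‖x i‖ ≤ 1) (S : ℕ → Finset (Fin N)) {t T : ℕ}
    (ht : t ≤ T) :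
    Real.log (designMatrix 1 x S t).det ≤ d * Real.log (1 + (T : ℝ) * N) := by
  have hA := designMatrix_posDef x S t
  have h := hA.det_le_pow (dotProduct_designMatrix_mulVec_le hx S t)
  have htT : (t : ℝ) ≤ T := by exact_mod_cast ht
  have h2 : (1 + (t : ℝ) * N) ^ d ≤ (1 + (T : ℝ) * N) ^ d := by gcongr
  rw [← Real.log_pow]
  exact Real.log_le_log hA.det_pos (h.trans h2)

/-- Taking logarithms, ‖s‖² is at most (log det A)/4 + log(T/δ)/2, and both terms are controlled by
multiples of dL with total below 1. -/
theorem sqrt_invQuad_le_of_expProcess_lt (hx : ∀ i, ‖x i‖ ≤ 1) (S : ℕ → Finset (Fin N))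
    {t T : ℕ} (ht : t < T) (hd : 1 ≤ d) (hN : 1 ≤ N) {δ : ℝ} (hδ : 0 < δ) (hδ1 : δ < 1)
    (s : Fin d → ℝ) (h : expProcess (designMatrix 1 x S t, s) < T / δ) :
    √(invQuad (designMatrix 1 x S t) s) ≤ √((d : ℝ) * Real.log ((1 + (T : ℝ) * N) / δ)) := by
  have hA := designMatrix_posDef x S t
  have hdet := log_det_designMatrix_le hx S ht.le
  have hT : (0 : ℝ) < T := by exact_mod_cast (Nat.zero_le t).trans_lt ht
  have hd' : (1 : ℝ) ≤ d := by exact_mod_cast hd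
  have hN' : (1 : ℝ) ≤ N := by exact_mod_cast hN
  have hTN : (T : ℝ) ≤ 1 + T * N := by nlinarith
  set A := designMatrix 1 x S t
  refine Real.sqrt_le_sqrt ?_
  have h1 : Real.log (expProcess (A, s)) = 2 * invQuad A s - Real.log A.det / 2 := by
    simp only [expProcess]
    rw [Real.log_div (Real.exp_ne_zero _) (Real.sqrt_pos.2 hA.det_pos).ne', Real.log_exp,
      Real.log_sqrt hA.det_pos.le]
  have hpos : 0 < expProcess (A, s) :=
    div_pos (Real.exp_pos _) (Real.sqrt_pos.2 hA.det_pos)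
  have h2 := Real.log_lt_log hpos h
  rw [h1, Real.log_div hT.ne' hδ.ne'] at h2
  rw [Real.log_div (by positivity) hδ.ne']
  have h3 := Real.log_le_log hT hTN
  have h4 : Real.log δ < 0 := Real.log_neg hδ hδ1
  have h5 : 0 ≤ Real.log (1 + (T : ℝ) * N) := Real.log_nonneg (by nlinarith)
  nlinarith

/-- Optimism: the upper confidence values dominate μ on the comparison set S', S maximizes their
sum, and on S they exceed μ by at most twice the confidence radius. -/
theorem sum_le_sum_add_of_isTopSet {K : ℕ} {μ w p : Fin N → ℝ} {α : ℝ} {S S' : Finset (Fin N)}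
    (hp : ∀ i, |p i - μ i| ≤ α * w i) (hS : IsTopSet K (fun i => p i + α * w i) S)
    (hS' : S'.card = K) :
    ∑ i ∈ S', μ i ≤ ∑ i ∈ S, μ i + 2 * α * ∑ i ∈ S, w i := by
  calc ∑ i ∈ S', μ i ≤ ∑ i ∈ S', (p i + α * w i) :=
        Finset.sum_le_sum fun i _ => by linarith [neg_abs_le (p i - μ i), hp i]
    _ ≤ ∑ i ∈ S, (p i + α * w i) := hS.2 S' hS'
    _ ≤ ∑ i ∈ S, (μ i + 2 * α * w i) :=
        Finset.sum_le_sum fun i _ => by linarith [le_abs_self (p i - μ i), hp i]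
    _ = ∑ i ∈ S, μ i + 2 * α * ∑ i ∈ S, w i := by rw [Finset.sum_add_distrib, Finset.mul_sum]

/-- The widths of one batch, bounded by the increase `D` of the log-determinant: batches with
`D > 1` are paid for by `K * D`, the others by the Cauchy–Schwarz inequality. -/
theorem sum_sqrt_invQuad_le (hx : ∀ i, ‖x i‖ ≤ 1) (S : ℕ → Finset (Fin N)) {K t : ℕ}
    (hK : (S t).card = K) {D : ℝ}
    (hD : D = Real.log (designMatrix 1 x S (t + 1)).det - Real.log (designMatrix 1 x S t).det) :
    0 ≤ D ∧ ∑ i ∈ S t, √(invQuad (designMatrix 1 x S t) (x i).ofLp) ≤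
      K * D + 2 * √K * √D := by
  have hA := designMatrix_posDef x S t
  have hD0 : 0 ≤ D := by
    rw [hD, sub_nonneg]
    exact Real.log_le_log hA.det_pos
      (hA.det_le_det_add_sum_vecMulVec (fun i => (x i).ofLp) (S t))
  refine ⟨hD0, ?_⟩
  have hW := hA.sum_invQuad_le (fun i => (x i).ofLp) (S t) (D := D) hD
  set A := designMatrix 1 x S t
  rcases le_or_gt D 1 with h | h
  -- The crude bound e ≤ 4 has the convenient square root 2.
  · have hexp : Real.exp D ≤ 4 :=
      (Real.exp_le_exp.2 h).trans (Real.exp_one_lt_d9.le.trans (by norm_num))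
    have hcs := sq_sum_le_card_mul_sum_sq (s := S t) (f := fun i => √(invQuad A (x i).ofLp))
    simp_rw [Real.sq_sqrt (hA.invQuad_nonneg _)] at hcs
    have hle : (∑ i ∈ S t, √(invQuad A (x i).ofLp)) ^ 2 ≤ 4 * (K * D) := by
      rw [hK] at hcs
      refine hcs.trans ?_
      have : ∑ i ∈ S t, invQuad A (x i).ofLp ≤ 4 * D :=
        hW.trans (mul_le_mul_of_nonneg_right hexp hD0)
      nlinarith [mul_le_mul_of_nonneg_left this (Nat.cast_nonneg (α := ℝ) K)]
    have h2 := Real.le_sqrt_of_sq_le hle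
    have h4 : √(4 * (K * D)) = 2 * √K * √D := by
      rw [Real.sqrt_mul (by norm_num), Real.sqrt_mul (Nat.cast_nonneg K),
        show (4 : ℝ) = 2 ^ 2 by norm_num, Real.sqrt_sq (by norm_num)]
      ring
    have : 0 ≤ K * D := by positivity
    linarith
  · have h1 : ∑ i ∈ S t, √(invQuad A (x i).ofLp) ≤ ∑ _i ∈ S t, (1 : ℝ) :=
      Finset.sum_le_sum fun i _ => Real.sqrt_le_one.2 (invQuad_designMatrix_le_one S t (hx i))
    rw [Finset.sum_const, hK, nsmul_eq_mul] at h1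
    have : (K : ℝ) * 1 ≤ K * D := mul_le_mul_of_nonneg_left h.le (Nat.cast_nonneg K)
    have : 0 ≤ 2 * √(K : ℝ) * √D := by positivity
    linarith

/-- The increments D telescope to the final log det, since the initial determinant is 1; a second
Cauchy–Schwarz, over periods, handles the √D terms. -/
theorem sum_sum_sqrt_invQuad_le (hx : ∀ i, ‖x i‖ ≤ 1) (S : ℕ → Finset (Fin N)) {K T : ℕ}
    (hK : ∀ t < T, (S t).card = K) :
    ∑ t ∈ Finset.range T, ∑ i ∈ S t, √(invQuad (designMatrix 1 x S t) (x i).ofLp) ≤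
      K * (d * Real.log (1 + (T : ℝ) * N)) +
        2 * √(K * T) * √(d * Real.log (1 + (T : ℝ) * N)) := by
  set D : ℕ → ℝ := fun t =>
    Real.log (designMatrix 1 x S (t + 1)).det - Real.log (designMatrix 1 x S t).det with hD
  have hstep (t) (ht : t ∈ Finset.range T) := sum_sqrt_invQuad_le hx S
    (hK t (Finset.mem_range.1 ht)) (D := D t) rfl
  have hsum : ∑ t ∈ Finset.range T, D t ≤ d * Real.log (1 + (T : ℝ) * N) := by
    rw [hD, Finset.sum_range_sub fun t => Real.log (designMatrix 1 x S t).det]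
    have h0 : Real.log (designMatrix 1 x S 0).det = 0 := by simp [designMatrix]
    rw [h0, sub_zero]
    exact log_det_designMatrix_le hx S le_rfl
  have hsqrt : ∑ t ∈ Finset.range T, √(D t) ≤
      √T * √(d * Real.log (1 + (T : ℝ) * N)) := by
    rw [← Real.sqrt_mul (Nat.cast_nonneg T)]
    refine Real.le_sqrt_of_sq_le (sq_sum_le_card_mul_sum_sq.trans ?_)
    rw [Finset.card_range, Finset.sum_congr rfl fun t ht => Real.sq_sqrt (hstep t ht).1]
    exact mul_le_mul_of_nonneg_left hsum (Nat.cast_nonneg T)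
  calc ∑ t ∈ Finset.range T, ∑ i ∈ S t, √(invQuad (designMatrix 1 x S t) (x i).ofLp)
      ≤ ∑ t ∈ Finset.range T, (K * D t + 2 * √K * √(D t)) :=
        Finset.sum_le_sum fun t ht => (hstep t ht).2
    _ = K * ∑ t ∈ Finset.range T, D t + 2 * √K * ∑ t ∈ Finset.range T, √(D t) := by
        rw [Finset.sum_add_distrib, Finset.mul_sum, Finset.mul_sum]
    _ ≤ K * (d * Real.log (1 + (T : ℝ) * N)) +
        2 * √K * (√T * √(d * Real.log (1 + (T : ℝ) * N))) := by gcongr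
    _ = _ := by rw [Real.sqrt_mul (Nat.cast_nonneg K)]; ring

theorem regret_le_of_confidence {K T : ℕ} {r : ℕ → Fin N → ℝ} {S : ℕ → Finset (Fin N)}
    {Sopt : Finset (Fin N)} {α : ℝ} (hα : 0 ≤ α) (hx : ∀ i, ‖x i‖ ≤ 1)
    (hopt : Sopt.card = K) (hrun : IsSemiUCBRun α 1 K T x S r)
    (hconf : ∀ t < T, ∀ i, |(x i).ofLp ⬝ᵥ thetaHat 1 x S r t - saleProb x θ i| ≤
      α * √(invQuad (designMatrix 1 x S t) (x i).ofLp)) :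
    regret T (saleProb x θ) Sopt S ≤ 2 * α * (K * (d * Real.log (1 + (T : ℝ) * N)) +
      2 * √(K * T) * √(d * Real.log (1 + (T : ℝ) * N))) := by
  have hstep : ∑ _t ∈ Finset.range T, ∑ i ∈ Sopt, saleProb x θ i ≤
      ∑ t ∈ Finset.range T, (∑ i ∈ S t, saleProb x θ i +
        2 * α * ∑ i ∈ S t, √(invQuad (designMatrix 1 x S t) (x i).ofLp)) :=
    Finset.sum_le_sum fun t ht => by
      have ht' := Finset.mem_range.1 ht
      exact sum_le_sum_add_of_isTopSet (hconf t ht') (hrun t ht') hopt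
  rw [Finset.sum_add_distrib, ← Finset.mul_sum] at hstep
  have h := mul_le_mul_of_nonneg_left
    (sum_sum_sqrt_invQuad_le hx S fun t ht => (hrun t ht).1) (mul_nonneg zero_le_two hα)
  rw [regret]
  linarith

/-- The threshold 0.64 = 0.8² lies below log 2 and makes 2√L and 2L at least 1. The arising powers
L^{3/2} and L can thus be raised to the integer power L² at the cost of a factor 2, whence 24 = 2 ·
12. -/
theorem soft_bound {d K T ℓ L : ℝ} (hd : 1 ≤ d) (hK : 0 ≤ K) (hℓ : 0 ≤ ℓ)
    (hℓL : ℓ ≤ L) (hL : 0.64 ≤ L) :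
    2 * (√(d * L) + 1) * (K * (d * ℓ) + 2 * √(K * T) * √(d * ℓ)) ≤
      24 * (K * d ^ (3 / 2 : ℝ) + d * √(K * T)) * L ^ 2 := by
  have hd0 : 0 ≤ d := by linarith
  have hL0 : 0 ≤ L := by linarith
  set a := √d with ha
  set q := √L with hq
  have hda : d = a ^ 2 := (Real.sq_sqrt hd0).symm
  have hLq : L = q ^ 2 := (Real.sq_sqrt hL0).symm
  have ha1 : 1 ≤ a := Real.one_le_sqrt.2 hd
  have hq1 : 0.8 ≤ q := Real.le_sqrt_of_sq_le (by norm_num at hL ⊢; linarith)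
  have hq1' : 4 / 5 ≤ q := by norm_num at hq1; linarith
  have hpow : d ^ (3 / 2 : ℝ) = a ^ 3 := by
    rw [ha, Real.sqrt_eq_rpow, ← Real.rpow_natCast, ← Real.rpow_mul hd0]
    norm_num
  have hdL : √(d * L) = a * q := Real.sqrt_mul hd0 L
  have h1 : √(d * ℓ) ≤ a * q := hdL ▸ Real.sqrt_le_sqrt (mul_le_mul_of_nonneg_left hℓL hd0)
  have haq : 4 / 5 ≤ a * q := by nlinarith
  set R := √(K * T)
  have hR : 0 ≤ R := Real.sqrt_nonneg _
  have ha0 : 0 ≤ a := by linarith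
  have hq0 : 0 ≤ q := by linarith
  have h2 : K * (d * ℓ) + 2 * R * √(d * ℓ) ≤ K * (a ^ 2 * q ^ 2) + 2 * R * (a * q) := by
    rw [← hda, ← hLq]
    gcongr
  have h3 : 2 * (√(d * L) + 1) ≤ 6 * (a * q) := by rw [hdL]; linarith
  have hq3 : q ^ 3 ≤ 2 * q ^ 4 := by nlinarith [pow_nonneg hq0 3]
  have hq2 : q ^ 2 ≤ 2 * q ^ 4 := by
    have : (4 / 5 : ℝ) * (4 / 5) ≤ q * q := mul_le_mul hq1' hq1' (by norm_num) hq0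
    nlinarith [pow_nonneg hq0 2]
  calc 2 * (√(d * L) + 1) * (K * (d * ℓ) + 2 * R * √(d * ℓ))
      ≤ 6 * (a * q) * (K * (a ^ 2 * q ^ 2) + 2 * R * (a * q)) := by
        refine mul_le_mul h3 h2 (by positivity) (by positivity)
    _ = 6 * (K * a ^ 3) * q ^ 3 + 12 * (a ^ 2 * R) * q ^ 2 := by ring
    _ ≤ 6 * (K * a ^ 3) * (2 * q ^ 4) + 12 * (a ^ 2 * R) * (2 * q ^ 4) := by gcongr
    _ ≤ 24 * (K * a ^ 3 + a ^ 2 * R) * (q ^ 2) ^ 2 := by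
        have : 0 ≤ K * a ^ 3 * q ^ 4 := by positivity
        nlinarith
    _ = 24 * (K * d ^ (3 / 2 : ℝ) + d * R) * L ^ 2 := by rw [hpow, ← hda, ← hLq]

theorem regret_eq_zero_of_degenerate {T : ℕ} (h : d = 0 ∨ N = 0 ∨ T = 0)
    (Sopt : Finset (Fin N)) (S : ℕ → Finset (Fin N)) :
    regret T (saleProb x θ) Sopt S = 0 := by
  rcases h with rfl | rfl | rfl
  · simp [regret, saleProb]
  · simp [regret, Finset.eq_empty_of_isEmpty]
  · simp [regret]

end Deterministic

/-! ### Assembly of the confidence event and the regret bound. -/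

theorem theorem1 :
    -- absolute constants: the constant and the power of the logarithm hidden in the soft-O
    ∃ C : ℝ, ∃ p : ℕ, 0 < C ∧
      ∀ (d N K T : ℕ) (δ : ℝ), 0 < δ → δ < 1 →
      ∀ (x : Fin N → EuclideanSpace ℝ (Fin d)) (θ : EuclideanSpace ℝ (Fin d)),
        (∀ i, ‖x i‖ ≤ 1) → ‖θ‖ ≤ 1 →
        (∀ i, saleProb x θ i ∈ Set.Icc (0 : ℝ) 1) →
      ∀ Sopt : Finset (Fin N), IsTopSet K (saleProb x θ) Sopt →
      ∀ (Ω : Type*) (mΩ : MeasurableSpace Ω) (P : Measure Ω) (_ : IsProbabilityMeasure P)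
        -- `ℱ t` is the information available just before period `t`
        (ℱ : Filtration ℕ mΩ)
        (r : ℕ → Fin N → Ω → ℝ) (S : ℕ → Ω → Finset (Fin N)),
        -- the outcomes are binary with means `μ(i)`, independent across products and periods
        (∀ t < T, ∀ i ω, r t i ω = 0 ∨ r t i ω = 1) →
        (∀ t < T, ∀ i, ∫ ω, r t i ω ∂P = saleProb x θ i) →
        iIndepFun (fun (q : Fin T × Fin N) => r q.1 q.2) P →
        -- they are known after their period and independent of the information before it
        (∀ t < T, ∀ i, Measurable[ℱ (t + 1)] (r t i)) →
        (∀ t < T, Indep (ℱ t) (⨆ i, MeasurableSpace.comap (r t i) inferInstance) P) →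
        -- the decision of period `t` is based on the information available before it
        (∀ t < T, ∀ s : Finset (Fin N), MeasurableSet[ℱ t] {ω | S t ω = s}) →
        -- the decisions are those of SemiUCB with the stated parameters
        (∀ ω, IsSemiUCBRun (√((d : ℝ) * Real.log ((1 + (T : ℝ) * N) / δ)) + 1) 1 K T x
          (fun t => S t ω) (fun t i => r t i ω)) →
        1 - δ ≤ P.real {ω | regret T (saleProb x θ) Sopt (fun t => S t ω) ≤
          C * ((K : ℝ) * (d : ℝ) ^ (3 / 2 : ℝ) + (d : ℝ) * √((K : ℝ) * T)) *
            Real.log ((1 + (T : ℝ) * N) / δ) ^ p} := by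
  refine ⟨24, 2, by norm_num, ?_⟩
  intro d N K T δ hδ hδ1 x θ hx hθ hμ Sopt hopt Ω mΩ P _ ℱ r S hr hmean hind hrm hindF hS hrun
  have hquot : 1 ≤ (1 + (T : ℝ) * N) / δ := by
    rw [le_div_iff₀ hδ]
    have : (0 : ℝ) ≤ T * N := by positivity
    linarith
  have hL0 : 0 ≤ Real.log ((1 + (T : ℝ) * N) / δ) := Real.log_nonneg hquot
  -- Outside these cases, where the regret vanishes, TN ≥ 1 and hence L ≥ log 2, which bounds the
  -- logarithm away from 0.
  by_cases hdeg : d = 0 ∨ N = 0 ∨ T = 0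
  · have huniv : {ω | regret T (saleProb x θ) Sopt (fun t => S t ω) ≤
        24 * ((K : ℝ) * (d : ℝ) ^ (3 / 2 : ℝ) + (d : ℝ) * √((K : ℝ) * T)) *
          Real.log ((1 + (T : ℝ) * N) / δ) ^ 2} = Set.univ := by
      refine Set.eq_univ_of_forall fun ω => ?_
      rw [Set.mem_ofPred_eq, regret_eq_zero_of_degenerate hdeg]
      positivity
    rw [huniv, probReal_univ]
    linarith
  push Not at hdeg
  obtain ⟨hd, hN, hT⟩ := hdeg
  have hd1 : 1 ≤ d := Nat.one_le_iff_ne_zero.2 hd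
  have hN1 : 1 ≤ N := Nat.one_le_iff_ne_zero.2 hN
  have hT1 : 1 ≤ T := Nat.one_le_iff_ne_zero.2 hT
  set bad : Set Ω := {ω | ∃ t < T, T / δ ≤ expProcess (noiseState x (saleProb x θ) S r t ω)}
  have hbad : P.real bad ≤ δ :=
    measure_exists_expProcess_ge_le hμ hr hmean hind hrm hindF hS hδ hT1
  have hgood : badᶜ ⊆ {ω | regret T (saleProb x θ) Sopt (fun t => S t ω) ≤
      24 * ((K : ℝ) * (d : ℝ) ^ (3 / 2 : ℝ) + (d : ℝ) * √((K : ℝ) * T)) *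
        Real.log ((1 + (T : ℝ) * N) / δ) ^ 2} := by
    intro ω hω
    simp only [bad, Set.mem_compl_iff, Set.mem_ofPred_eq, not_exists, not_and, not_le] at hω
    have hTN : (1 : ℝ) ≤ T * N := by exact_mod_cast Nat.mul_pos hT1 hN1
    have hα : 0 ≤ √((d : ℝ) * Real.log ((1 + (T : ℝ) * N) / δ)) + 1 := by positivity
    refine (regret_le_of_confidence hα hx hopt.1 (hrun ω) fun t ht i => ?_).trans ?_
    · refine (abs_dotProduct_thetaHat_sub_le hθ _ _ t i).trans ?_
      refine mul_le_mul_of_nonneg_right ?_ (Real.sqrt_nonneg _)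
      have := sqrt_invQuad_le_of_expProcess_lt hx (fun t => S t ω) ht hd1 hN1 hδ hδ1 _ (hω t ht)
      exact add_le_add_left this 1
    · have hℓL : Real.log (1 + (T : ℝ) * N) ≤ Real.log ((1 + (T : ℝ) * N) / δ) :=
        Real.log_le_log (by positivity) (le_div_self (by positivity) hδ hδ1.le)
      have h2 : Real.log 2 ≤ Real.log (1 + (T : ℝ) * N) :=
        Real.log_le_log (by norm_num) (by linarith)
      have h3 := Real.log_two_gt_d9
      refine soft_bound (by exact_mod_cast hd1) (Nat.cast_nonneg K) ?_ hℓL ?_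
      · linarith
      · norm_num at h3 ⊢
        linarith
  have h1 : (1 : ℝ) ≤ P.real bad + P.real badᶜ := by
    rw [← probReal_univ (μ := P), ← Set.union_compl_self bad]
    exact measureReal_union_le _ _
  have h2 := measureReal_mono (μ := P) hgood
  linarith
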